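/- Let $p$ be an odd prime, and let $1\to N\to\Gamma\to G\to 1$ be a short exact sequence of groups, where $N$ is an elementary abelian $p$-group of finite rank and $G$ is a finite group. Since $N$ is abelian, conjugation in $\Gamma$ induces an action of $G=\Gamma/N$ on $N$; let $\phi$ be the resulting representation of $G$ on the $\mathbb{F}_p$-vector space $N$, let $\tilde\phi$ be the dual (contragredient) representation of $\phi$, and let $V_{\tilde\phi}$ and $V_{\tilde\phi\wedge\tilde\phi}$ be the $\mathbb{F}_pG$-modules given by $\tilde\phi$ and by its exterior square $\tilde\phi\wedge\tilde\phi$. (i) For every finitely generated projective $\mathbb{F}_pG$-module $V$, viewed also as an $\mathbb{F}_p\Gamma$-module by inflation along $\Gamma\to G$, there is an isomorphism of $\mathbb{F}_p$-vector spaces $$\mathrm{H}^2(\Gamma,\mathrm{Hom}_{\mathbb{F}_p}(V,V))\;\cong\;\bigl[(V_{\tilde\phi}\otimes V^*\otimes V)\oplus(V_{\tilde\phi\wedge\tilde\phi}\otimes V^*\otimes V)\bigr]^{G}.$$ Here $V^*=\mathrm{Hom}_{\mathbb{F}_p}(V,\mathbb{F}_p)$ carries the dual action, tensor products are over $\mathbb{F}_p$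 with diagonal action, $\Gamma$ acts on $\mathrm{Hom}_{\mathbb{F}_p}(V,V)$ by conjugation, and $[\,\cdot\,]^G$ denotes the fixed points of $G$. (ii) If $N$ has rank two, then $\tilde\phi\wedge\tilde\phi$ is isomorphic to the one-dimensional representation $\det\circ\tilde\phi$ of $G$. -/

import Mathlib

noncomputable section

namespace GroupExtension

variable {p : ℕ} {N Γ G : Type*} [AddCommGroup N] [Module (ZMod p) N] [Group Γ] [Group G]

/-- Let `1 → N → Γ → G → 1` be a group extension whose kernel `N` is (the multiplicative group
of) an `𝔽_p`-vector space. This is the `𝔽_p`-linear action of `Γ` on `N` by conjugation: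
`e` sends `n` to `e n e⁻¹`. -/
def conjRep (E : GroupExtension (Multiplicative N) Γ G) : Representation (ZMod p) Γ N where
  toFun e := (AddMonoidHom.toMultiplicative.symm (E.conjAct e).toMonoidHom).toZModLinearMap p
  map_one' := by ext n; simp
  map_mul' a b := by ext n; simp

/-- `conjRep` is conjugation inside `Γ`. -/
theorem inl_conjRep (E : GroupExtension (Multiplicative N) Γ G) (e : Γ) (n : N) :
    E.inl (Multiplicative.ofAdd (E.conjRep (p := p) e n))
      = e * E.inl (Multiplicative.ofAdd n) * e⁻¹ :=
  E.inl_conjAct_comm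

/-- Conjugation on `N` depends only on the image in `G`, because `N` is abelian. -/
theorem conjRep_eq_of_rightHom_eq (E : GroupExtension (Multiplicative N) Γ G) {a b : Γ}
    (h : E.rightHom a = E.rightHom b) : E.conjRep (p := p) a = E.conjRep b := by
  have hk : b⁻¹ * a ∈ E.inl.range := by
    rw [E.range_inl_eq_ker_rightHom, MonoidHom.mem_ker, map_mul, map_inv, h, inv_mul_cancel]
  obtain ⟨m, hm⟩ := hk
  obtain rfl : a = b * E.inl m := by rw [hm, mul_inv_cancel_left]
  refine LinearMap.ext fun n => Multiplicative.ofAdd.injective (E.inl_injective ?_)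
  rw [inl_conjRep, inl_conjRep]
  have hc : E.inl m * E.inl (Multiplicative.ofAdd n) = E.inl (Multiplicative.ofAdd n) * E.inl m := by
    rw [← map_mul, ← map_mul, mul_comm]
  rw [mul_inv_rev, mul_assoc b, hc]
  group

/-- The representation `φ` of `G` over `𝔽_p` on the kernel `N` of the extension: `g` acts by
conjugation by any lift of `g` to `Γ`. -/
def kernelRep (E : GroupExtension (Multiplicative N) Γ G) : Representation (ZMod p) G N where
  toFun g := E.conjRep (Function.surjInv E.rightHom_surjective g)
  map_one' := by
    rw [← map_one E.conjRep]
    exact E.conjRep_eq_of_rightHom_eq (by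
      rw [Function.surjInv_eq E.rightHom_surjective, map_one])
  map_mul' a b := by
    rw [← map_mul E.conjRep]
    exact E.conjRep_eq_of_rightHom_eq (by
      simp only [map_mul, Function.surjInv_eq E.rightHom_surjective])

/-- The defining property of `kernelRep`: `g` acts on `N` by conjugation by any lift `e`. -/
theorem inl_kernelRep (E : GroupExtension (Multiplicative N) Γ G) (e : Γ) (n : N) :
    E.inl (Multiplicative.ofAdd (E.kernelRep (p := p) (E.rightHom e) n))
      = e * E.inl (Multiplicative.ofAdd n) * e⁻¹ := by
  rw [← E.inl_conjRep (p := p)]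
  have h : E.kernelRep (p := p) (E.rightHom e) = E.conjRep e :=
    E.conjRep_eq_of_rightHom_eq (Function.surjInv_eq E.rightHom_surjective _)
  rw [h]

end GroupExtension

namespace Representation

variable {k G W : Type*} [CommRing k] [Group G] [AddCommGroup W] [Module k W]

/-- The exterior square `ρ ∧ ρ` of a representation: `g (x ∧ y) = g x ∧ g y`. -/
def exteriorSquare (ρ : Representation k G W) : Representation k G (⋀[k]^2 W) where
  toFun g := exteriorPower.map 2 (ρ g)
  map_one' := by
    rw [map_one]
    exact exteriorPower.map_id
  map_mul' a b := by
    rw [map_mul]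
    exact exteriorPower.map_comp (ρ b) (ρ a)

/-- The one-dimensional representation `det ∘ ρ`: `g` acts on `k` as multiplication by
`det (ρ g)`. -/
def detRep (ρ : Representation k G W) : Representation k G k where
  toFun g := LinearMap.mulLeft k (LinearMap.det (ρ g))
  map_one' := by ext; simp
  map_mul' a b := by ext; simp

open scoped _root_.TensorProduct in
/-- The fixed points `[(W ⊗ V* ⊗ V) ⊕ (W' ⊗ V* ⊗ V)]^G`, where `G` acts on `W`, `W'`, `V` through
`σ`, `σ'`, `ρ`, on `V*` through the dual of `ρ`, and diagonally on tensor products and on the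
direct sum. -/
def fixedTensorSum {W' V : Type*} [AddCommGroup W'] [Module k W'] [AddCommGroup V] [Module k V]
    (σ : Representation k G W) (σ' : Representation k G W') (ρ : Representation k G V) :
    Submodule k ((W ⊗[k] Module.Dual k V ⊗[k] V) × (W' ⊗[k] Module.Dual k V ⊗[k] V)) :=
  invariants (V := (W ⊗[k] Module.Dual k V ⊗[k] V) × (W' ⊗[k] Module.Dual k V ⊗[k] V))
    (prod (tprod (tprod σ (dual ρ)) ρ) (tprod (tprod σ' (dual ρ)) ρ))

end Representation

end

/-! Write `M = End V`, a `G`-module on which `N` acts trivially. The theorem combines two facts: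
restriction identifies `H²(Γ, M)` with the `G`-invariants of `H²(N, M)`, and `H²(N, M)` is `Hom(N,
M) ⊕ Alt²(N, M)`.

A cocycle on `N` describes a central extension of `N` by `M`. Its `p`-th power map and commutator
pairing (`powerCommutator`) depend only on the cohomology class; `p` odd makes the power map linear.
If both vanish, the extension is an `𝔽_p`-vector space, so it splits
(`exists_coboundary_of_powerCommutator_eq_zero`). Every linear map and alternating form occur:
carries realise the first, half the form the second (`exists_powerCommutator_eq`).

Projectivity of `V` enters through Higman's criterion: some linear `θ` on `M` satisfies `∑ g θ g⁻¹ =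
1`. Twisting by `θ` and summing over `G` turns `N`-invariant homogeneous cochains into
`Γ`-equivariant ones and fixes those already equivariant (`transfer_smul`, `transfer_eq_self`).
Applied to a cochain bounding the restriction this gives injectivity, and applied to an extended
cocycle it gives surjectivity, onto the equivariant pairs (`nonempty_H2_equiv`).

Linear algebra, with 2 invertible, then identifies these pairs with the fixed points of the tensor
modules (`nonempty_fixedTensorSum_equiv`). For (ii), a basis determinant induces an isomorphism from
the exterior square to the field, on which `g` scales by its determinant. -/

set_option linter.unusedSectionVars false

/-! ### Power map and commutator pairing of a cocycle -/

section TrivialCocycles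

variable (p : ℕ) (N M : Type*) [AddCommGroup N] [Module (ZMod p) N] [AddCommGroup M]
  [Module (ZMod p) M]

/-- The 2-cocycles of the additive group `N` with values in the trivial module `M`. -/
def trivialCocycles : Submodule (ZMod p) (N → N → M) where
  carrier := {f | ∀ a b c, f (a + b) c + f a b = f b c + f a (b + c)}
  zero_mem' := by simp
  add_mem' {f g} hf hg a b c := by
    have h1 := hf a b c
    have h2 := hg a b c
    simp only [Pi.add_apply]
    linear_combination (norm := module) h1 + h2
  smul_mem' r f hf a b c := by
    simp only [Pi.smul_apply, ← smul_add, hf a b c]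

variable {p N M}

/-- The sum `f(a, 0) + f(a, a) + ⋯ + f(a, (n - 1) a)`, which measures the `n`-th power of a lift
of `a` to the extension given by `f`. -/
def powSum (f : N → N → M) (n : ℕ) (a : N) : M := ∑ i ∈ Finset.range n, f a (i • a)

theorem powSum_succ (f : N → N → M) (n : ℕ) (a : N) :
    powSum f (n + 1) a = powSum f n a + f a (n • a) := Finset.sum_range_succ _ _

theorem commutator_add_left {f : N → N → M} (hf : f ∈ trivialCocycles p N M) (a b c : N) :
    f (a + b) c - f c (a + b) = (f a c - f c a) + (f b c - f c b) := by
  have h1 := hf a b c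
  have h2 := hf c a b
  have h3 := hf a c b
  rw [add_comm c a] at h2
  rw [add_comm c b] at h3
  linear_combination (norm := module) h1 + h2 - h3

theorem commutator_add_right {f : N → N → M} (hf : f ∈ trivialCocycles p N M) (a b c : N) :
    f a (b + c) - f (b + c) a = (f a b - f b a) + (f a c - f c a) := by
  have h := commutator_add_left hf b c a
  linear_combination (norm := module) -h

theorem commutator_nsmul_right {f : N → N → M} (hf : f ∈ trivialCocycles p N M) (a b : N)
    (n : ℕ) : f a (n • b) - f (n • b) a = n • (f a b - f b a) := by
  induction n with
  | zero =>
    have h1 := hf a 0 0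
    have h2 := hf 0 0 a
    simp only [add_zero, zero_add, zero_smul] at h1 h2 ⊢
    linear_combination (norm := module) h1 + h2
  | succ n ih => rw [succ_nsmul, commutator_add_right hf, ih, succ_nsmul]

/-- This is `(xy)ⁿ = xⁿ yⁿ [y, x]^(n choose 2)` for lifts `x`, `y` in a central extension. The term
`f 0 0` appears because cocycles are not normalised. -/
theorem powSum_add {f : N → N → M} (hf : f ∈ trivialCocycles p N M) (n : ℕ) (a b : N) :
    powSum f n (a + b) + n • f a b + f 0 0
      = powSum f n a + powSum f n b + f (n • a) (n • b) + n.choose 2 • (f b a - f a b) := by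
  induction n with
  | zero => simp [powSum]
  | succ n ih =>
    have hc := commutator_nsmul_right hf b a n
    have h1 := hf a b (n • a + n • b)
    have h2 := hf b (n • a) (n • b)
    have h3 := hf (n • a) b (n • b)
    have h4 := hf a (n • a) (b + n • b)
    rw [← add_assoc, add_comm b (n • a), add_assoc] at h1
    rw [add_comm b (n • a)] at h2
    simp only [powSum_succ, Nat.choose_succ_succ' n 1, Nat.choose_one_right, add_smul, one_smul,
      smul_add] at ih ⊢
    rw [add_comm (n • a) a, add_comm (n • b) b]
    linear_combination (norm := module) ih + hc + h1 - h2 + h3 - h4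

theorem natCast_smul_self_eq_zero (x : M) : p • x = 0 := by
  rw [← Nat.cast_smul_eq_nsmul (ZMod p), CharP.cast_eq_zero, zero_smul]

theorem nsmul_eq_zero_of_dvd {n : ℕ} (h : p ∣ n) (x : M) : n • x = 0 := by
  obtain ⟨m, rfl⟩ := h
  rw [mul_smul, natCast_smul_self_eq_zero]

/-- For odd `p` the commutator term dies because `p` divides `p.choose 2`. -/
theorem powSum_char_add [Fact p.Prime] (hp : p ≠ 2) {f : N → N → M}
    (hf : f ∈ trivialCocycles p N M) (a b : N) :
    powSum f p (a + b) = powSum f p a + powSum f p b := by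
  have h := powSum_add hf p a b
  have hd : p ∣ p.choose 2 :=
    (Fact.out : p.Prime).dvd_choose_self two_ne_zero
      (lt_of_le_of_ne (Fact.out : p.Prime).two_le (Ne.symm hp))
  rw [nsmul_eq_zero_of_dvd hd, natCast_smul_self_eq_zero, natCast_smul_self_eq_zero (p := p) a,
    natCast_smul_self_eq_zero (p := p) b] at h
  linear_combination (norm := module) h

/-- The invariants of a 2-cocycle of an elementary abelian `p`-group with trivial coefficients:
the `p`-th power map and the commutator pairing of the corresponding extension. -/
def powerCommutator (N M : Type*) [AddCommGroup N] [Module (ZMod p) N] [AddCommGroup M]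
    [Module (ZMod p) M] [Fact p.Prime] (hp : p ≠ 2) :
    trivialCocycles p N M →ₗ[ZMod p] (N →ₗ[ZMod p] M) × (N →ₗ[ZMod p] N →ₗ[ZMod p] M) where
  toFun f := (AddMonoidHom.toZModLinearMap p
      (AddMonoidHom.mk' (powSum f.1 p) (powSum_char_add hp f.2)),
    AddMonoidHom.toZModLinearMap p
      (AddMonoidHom.mk' (fun a => AddMonoidHom.toZModLinearMap p
        (AddMonoidHom.mk' (fun b => f.1 a b - f.1 b a) (commutator_add_right f.2 a)))
        fun a b => LinearMap.ext fun c => commutator_add_left f.2 a b c))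
  map_add' f g := by
    ext
    · simp [powSum, Finset.sum_add_distrib]
    · simp
      abel
  map_smul' r f := by
    ext
    · simp [powSum, Finset.smul_sum]
    · simp [smul_sub]

theorem powerCommutator_fst [Fact p.Prime] (hp : p ≠ 2) (f : trivialCocycles p N M) (a : N) :
    (powerCommutator N M hp f).1 a = powSum f.1 p a := rfl

theorem powerCommutator_snd [Fact p.Prime] (hp : p ≠ 2) (f : trivialCocycles p N M) (a b : N) :
    (powerCommutator N M hp f).2 a b = f.1 a b - f.1 b a := rfl

theorem powerCommutator_eq_of_coboundary [Fact p.Prime] (hp : p ≠ 2)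
    {f g : trivialCocycles p N M} (h : N → M)
    (hfg : ∀ a b, f.1 a b - g.1 a b = h b - h (a + b) + h a) :
    powerCommutator N M hp f = powerCommutator N M hp g := by
  -- Telescoping; at `n = p` the right side vanishes since `p` kills `N` and `M`.
  have key : ∀ (n : ℕ) (a : N),
      powSum f.1 n a - powSum g.1 n a = h 0 - h (n • a) + n • h a := by
    intro n a
    induction n with
    | zero => simp [powSum]
    | succ n ih =>
      have h1 := hfg a (n • a)
      rw [powSum_succ, powSum_succ, succ_nsmul', succ_nsmul]
      linear_combination (norm := module) ih + h1
  ext a b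
  · have := key p a
    rw [natCast_smul_self_eq_zero, natCast_smul_self_eq_zero, sub_self, add_zero] at this
    exact sub_eq_zero.1 this
  · have h1 := hfg a b
    have h2 := hfg b a
    rw [add_comm b a] at h2
    rw [powerCommutator_snd, powerCommutator_snd]
    linear_combination (norm := module) h1 - h2

theorem powerCommutator_map [Fact p.Prime] (hp : p ≠ 2) {N' M' : Type*} [AddCommGroup N']
    [Module (ZMod p) N'] [AddCommGroup M'] [Module (ZMod p) M'] (u : N' →ₗ[ZMod p] N)
    (T : M →ₗ[ZMod p] M') (f : trivialCocycles p N M) (g : trivialCocycles p N' M')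
    (hg : ∀ a b, g.1 a b = T (f.1 (u a) (u b))) :
    powerCommutator N' M' hp g = (T ∘ₗ (powerCommutator N M hp f).1 ∘ₗ u,
      ((powerCommutator N M hp f).2.compl₁₂ u u).compr₂ T) := by
  ext a b
  · simp [powerCommutator_fst, powSum, hg]
  · simp [powerCommutator_snd, hg]

end TrivialCocycles

/-! ### Splitting of abelian extensions of exponent `p` -/

section Extension

variable {p : ℕ} {N M : Type*} [AddCommGroup N] [Module (ZMod p) N] [AddCommGroup M]
  [Module (ZMod p) M]

/-- The extension of `N` by `M` given by a symmetric cocycle. -/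
@[ext]
structure CocycleExtension (f : N → N → M) where
  /-- The image in `N`. -/
  base : N
  /-- The coordinate in `M`. -/
  fibre : M

namespace CocycleExtension

/-- The abelian group structure on the extension given by a symmetric cocycle. -/
@[reducible]
def addCommGroup {f : N → N → M} (hf : f ∈ trivialCocycles p N M) (hs : ∀ a b, f a b = f b a) :
    AddCommGroup (CocycleExtension f) :=
  have h0 : ∀ a, f 0 a = f 0 0 := fun a => by
    have h := hf 0 0 a
    simp only [zero_add] at h
    linear_combination (norm := module) -h
  let _ : Add (CocycleExtension f) := ⟨fun x y => ⟨x.1 + y.1, x.2 + y.2 + f x.1 y.1⟩⟩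
  -- Without normalisation the neutral element has fibre coordinate `-f 0 0`, not 0.
  letI : Zero (CocycleExtension f) := ⟨⟨0, -f 0 0⟩⟩
  letI : Neg (CocycleExtension f) := ⟨fun x => ⟨-x.1, -x.2 - f x.1 (-x.1) - f 0 0⟩⟩
  have hz : ∀ x : CocycleExtension f, 0 + x = x := fun x => by
    refine CocycleExtension.ext (zero_add _) ?_
    change -f 0 0 + x.2 + f 0 x.1 = x.2
    rw [h0 x.1]
    abel
  have hc : ∀ x y : CocycleExtension f, x + y = y + x := fun x y => by
    refine CocycleExtension.ext (add_comm _ _) ?_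
    change x.2 + y.2 + f x.1 y.1 = y.2 + x.2 + f y.1 x.1
    rw [hs, add_comm x.2]
  { add_assoc := fun x y z => by
      refine CocycleExtension.ext (add_assoc _ _ _) ?_
      change x.2 + y.2 + f x.1 y.1 + z.2 + f (x.1 + y.1) z.1
        = x.2 + (y.2 + z.2 + f y.1 z.1) + f x.1 (y.1 + z.1)
      linear_combination (norm := module) hf x.1 y.1 z.1
    zero_add := hz
    add_zero := fun x => (hc x 0).trans (hz x)
    add_comm := hc
    neg_add_cancel := fun x => by
      refine CocycleExtension.ext (neg_add_cancel _) ?_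
      change -x.2 - f x.1 (-x.1) - f 0 0 + x.2 + f (-x.1) x.1 = -f 0 0
      rw [hs (-x.1)]
      abel
    nsmul := nsmulRec
    zsmul := zsmulRec }

end CocycleExtension

theorem exists_addMonoidHom_section [Fact p.Prime] {X : Type*} [AddCommGroup X]
    (hX : ∀ x : X, p • x = 0) (q : X →+ N) (hq : Function.Surjective q) :
    ∃ s : N →+ X, ∀ a, q (s a) = a := by
  let _ : Module (ZMod p) X := AddCommGroup.zmodModule hX
  obtain ⟨s, hs⟩ := (q.toZModLinearMap p).exists_rightInverse_of_surjective
    (LinearMap.range_eq_top.2 hq)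
  exact ⟨s.toAddMonoidHom, fun a => LinearMap.congr_fun hs a⟩

/-- Trivial commutators make the extension abelian and a trivial power map makes it of exponent `p`,
so it is a vector space and splits. The fibre coordinate of an additive section, negated, is the
required cochain. -/
theorem exists_coboundary_of_powerCommutator_eq_zero [Fact p.Prime] (hp : p ≠ 2)
    (f : trivialCocycles p N M) (h : powerCommutator N M hp f = 0) :
    ∃ t : N → M, ∀ a b, f.1 a b = t b - t (a + b) + t a := by
  have hs : ∀ a b, f.1 a b = f.1 b a := fun a b => by
    rw [← sub_eq_zero, ← powerCommutator_snd hp f, h]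
    rfl
  have hpow : ∀ a, powSum f.1 p a = 0 := fun a => by
    rw [← powerCommutator_fst hp f, h]
    rfl
  let _ : AddCommGroup (CocycleExtension f.1) := CocycleExtension.addCommGroup f.2 hs
  have hn : ∀ (n : ℕ) (x : CocycleExtension f.1),
      n • x = ⟨n • x.1, n • x.2 + powSum f.1 n x.1 - f.1 0 0⟩ := by
    intro n x
    induction n with
    | zero =>
      rw [zero_smul]
      refine CocycleExtension.ext (zero_smul _ _).symm ?_
      change -f.1 0 0 = _
      simp [powSum]
    | succ n ih =>
      rw [succ_nsmul', ih]
      refine CocycleExtension.ext (succ_nsmul' _ _).symm ?_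
      change x.2 + (n • x.2 + powSum f.1 n x.1 - f.1 0 0) + f.1 x.1 (n • x.1) = _
      rw [powSum_succ, succ_nsmul' x.2]
      module
  have ht : ∀ x : CocycleExtension f.1, p • x = 0 := fun x => by
    rw [hn]
    refine CocycleExtension.ext (natCast_smul_self_eq_zero _) ?_
    change p • x.2 + powSum f.1 p x.1 - f.1 0 0 = -f.1 0 0
    rw [hpow, natCast_smul_self_eq_zero]
    abel
  obtain ⟨s, hb⟩ := exists_addMonoidHom_section ht
    (AddMonoidHom.mk' (fun x : CocycleExtension f.1 => x.1) fun _ _ => rfl) fun a => ⟨⟨a, 0⟩, rfl⟩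
  refine ⟨fun a => -(s a).2, fun a b => ?_⟩
  have hab : (s (a + b)).2 = (s a).2 + (s b).2 + f.1 (s a).1 (s b).1 := by
    rw [map_add]
    rfl
  have hb' : ∀ a, (s a).1 = a := hb
  rw [hb', hb'] at hab
  linear_combination (norm := module) -hab

end Extension

/-! ### Realising power maps by carries and pairings by bilinear cocycles -/

section Carry

/-- The carry of the addition of two residues modulo `p`. -/
def ZMod.carry (p : ℕ) (x y : ZMod p) : ℕ := (x.val + y.val) / p

theorem ZMod.val_add_add_carry {p : ℕ} [NeZero p] (x y : ZMod p) :
    (x + y).val + p * ZMod.carry p x y = x.val + y.val := by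
  rw [ZMod.val_add, ZMod.carry, Nat.mod_add_div]

/-- Multiplied by `p`, each side is the sum of the three residues minus the residue of the total. -/
theorem ZMod.carry_cocycle {p : ℕ} [NeZero p] (x y z : ZMod p) :
    carry p (x + y) z + carry p x y = carry p y z + carry p x (y + z) := by
  have h1 := val_add_add_carry (x + y) z
  have h2 := val_add_add_carry x y
  have h3 := val_add_add_carry y z
  have h4 := val_add_add_carry x (y + z)
  rw [add_assoc] at h1
  refine Nat.eq_of_mul_eq_mul_left (NeZero.pos p) ?_
  rw [mul_add, mul_add]
  omega

theorem ZMod.carry_comm {p : ℕ} (x y : ZMod p) : carry p x y = carry p y x := by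
  rw [carry, carry, add_comm]

theorem ZMod.sum_carry {p : ℕ} [NeZero p] (x : ZMod p) :
    ∑ i ∈ Finset.range p, carry p x (i • x) = x.val := by
  have key : ∀ n : ℕ, p * ∑ i ∈ Finset.range n, carry p x (i • x) + (n • x).val = n * x.val := by
    intro n
    induction n with
    | zero => simp
    | succ n ih =>
      have h := val_add_add_carry x (n • x)
      rw [Finset.sum_range_succ, succ_nsmul', mul_add, add_mul, one_mul]
      omega
  have h := key p
  rw [nsmul_eq_mul, CharP.cast_eq_zero, zero_mul, ZMod.val_zero, add_zero] at h
  exact Nat.eq_of_mul_eq_mul_left (NeZero.pos p) h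

variable {p : ℕ} {N M : Type*} [AddCommGroup N] [Module (ZMod p) N] [AddCommGroup M]
  [Module (ZMod p) M]

/-- Coordinatewise carrying is the cocycle of `(ℤ/p²)^r` over `(ℤ/p)^r`, where multiplying a lift of
`x` by `p` recovers `x` in the kernel. -/
theorem exists_symmetric_cocycle_powSum [Fact p.Prime] [Finite N] :
    ∃ c : trivialCocycles p N N, (∀ a b, c.1 a b = c.1 b a) ∧ ∀ a, powSum c.1 p a = a := by
  have := Module.Finite.of_finite (R := ZMod p) (M := N)
  let b := Module.finBasis (ZMod p) N
  refine ⟨⟨fun x y => ∑ i, (ZMod.carry p (b.repr x i) (b.repr y i)) • b i, ?_⟩, ?_, ?_⟩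
  · intro x y z
    simp only [← Finset.sum_add_distrib, ← add_smul, map_add, Finsupp.add_apply,
      ZMod.carry_cocycle]
  · intro x y
    simp only [ZMod.carry_comm]
  · intro x
    simp only [powSum, map_nsmul, Finsupp.smul_apply]
    rw [Finset.sum_comm]
    simp only [← Finset.sum_smul, ZMod.sum_carry]
    conv_rhs => rw [← b.sum_repr x]
    refine Finset.sum_congr rfl fun i _ => ?_
    rw [← Nat.cast_smul_eq_nsmul (ZMod p), ZMod.natCast_zmod_val]

theorem ZMod.two_ne_zero_of_ne_two [Fact p.Prime] (hp : p ≠ 2) : (2 : ZMod p) ≠ 0 := fun h =>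
  hp ((Nat.prime_dvd_prime_iff_eq Fact.out Nat.prime_two).1
    ((CharP.cast_eq_zero_iff (ZMod p) p 2).1 (by exact_mod_cast h)))

theorem exists_powerCommutator_eq [Fact p.Prime] (hp : p ≠ 2) [Finite N]
    (l : N →ₗ[ZMod p] M) (B : N →ₗ[ZMod p] N →ₗ[ZMod p] M) (hB : ∀ a, B a a = 0) :
    ∃ f : trivialCocycles p N M, powerCommutator N M hp f = (l, B) := by
  obtain ⟨c, hc, hpow⟩ := exists_symmetric_cocycle_powSum (p := p) (N := N)
  have h2 := ZMod.two_ne_zero_of_ne_two hp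
  have hB' : ∀ a b, B b a = -B a b := fun a b => by
    have h := hB (a + b)
    simp only [map_add, LinearMap.add_apply, hB] at h
    linear_combination (norm := module) h
  -- Half of `B` has commutator pairing `B` and no power map, as `B` is alternating; the carry part
  -- is symmetric with power map `l`.
  refine ⟨⟨fun a b => (2 : ZMod p)⁻¹ • B a b + l (c.1 a b), fun x y z => ?_⟩, ?_⟩
  · have h := congrArg l (c.2 x y z)
    simp only [map_add, LinearMap.add_apply, smul_add] at h ⊢
    linear_combination (norm := module) h
  · ext a b
    · simp only [powerCommutator_fst, powSum, map_nsmul, hB, smul_zero,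
        zero_add, ← map_sum]
      exact congrArg l (hpow a)
    · simp only [powerCommutator_snd, hc b a, hB' a b, smul_neg]
      have : (2 : ZMod p) • (2 : ZMod p)⁻¹ • B a b = B a b := by
        rw [smul_smul, mul_inv_cancel₀ h2, one_smul]
      rw [two_smul] at this
      linear_combination (norm := module) this

end Carry

/-! ### Functoriality and equivariant pairs -/

section MapCocycle

variable {p : ℕ} {N M N' M' : Type*} [AddCommGroup N] [Module (ZMod p) N] [AddCommGroup M]
  [Module (ZMod p) M] [AddCommGroup N'] [Module (ZMod p) N'] [AddCommGroup M']
  [Module (ZMod p) M']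

/-- Functoriality of cocycles with trivial coefficients in the group and in the coefficients. -/
def trivialCocycles.map (u : N' →ₗ[ZMod p] N) (T : M →ₗ[ZMod p] M')
    (f : trivialCocycles p N M) : trivialCocycles p N' M' :=
  ⟨fun a b => T (f.1 (u a) (u b)), fun a b c => by
    simpa only [map_add] using congrArg T (f.2 (u a) (u b) (u c))⟩

/-- The representation on pairs of a linear and a bilinear map induced by representations on the
source and on the target. -/
noncomputable def Representation.linBilin {k G N M : Type*} [CommRing k] [Group G] [AddCommGroup N]
    [Module k N] [AddCommGroup M] [Module k M] (φ : Representation k G N)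
    (π : Representation k G M) :
    Representation k G ((N →ₗ[k] M) × (N →ₗ[k] N →ₗ[k] M)) :=
  (φ.linHom π).prod (φ.linHom (φ.linHom π))

theorem Representation.mem_linBilin_invariants {k G N M : Type*} [CommRing k] [Group G]
    [AddCommGroup N] [Module k N] [AddCommGroup M] [Module k M] {φ : Representation k G N}
    {π : Representation k G M} {q : (N →ₗ[k] M) × (N →ₗ[k] N →ₗ[k] M)} :
    q ∈ (φ.linBilin π).invariants ↔ ∀ g, (∀ a, π g (q.1 (φ g⁻¹ a)) = q.1 a) ∧
      ∀ a b, π g (q.2 (φ g⁻¹ a) (φ g⁻¹ b)) = q.2 a b := by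
  refine forall_congr' fun g => Prod.ext_iff.trans (and_congr LinearMap.ext_iff ?_)
  exact LinearMap.ext_iff₂

theorem Representation.apply_fst_of_mem_invariants {k G N M : Type*} [CommRing k] [Group G]
    [AddCommGroup N] [Module k N] [AddCommGroup M] [Module k M] {φ : Representation k G N}
    {π : Representation k G M} {q : (N →ₗ[k] M) × (N →ₗ[k] N →ₗ[k] M)}
    (hq : q ∈ (φ.linBilin π).invariants) (g : G) (a : N) : π g (q.1 a) = q.1 (φ g a) := by
  rw [← (mem_linBilin_invariants.1 hq g).1 (φ g a), inv_self_apply]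

theorem Representation.apply_snd_of_mem_invariants {k G N M : Type*} [CommRing k] [Group G]
    [AddCommGroup N] [Module k N] [AddCommGroup M] [Module k M] {φ : Representation k G N}
    {π : Representation k G M} {q : (N →ₗ[k] M) × (N →ₗ[k] N →ₗ[k] M)}
    (hq : q ∈ (φ.linBilin π).invariants) (g : G) (a b : N) :
    π g (q.2 a b) = q.2 (φ g a) (φ g b) := by
  rw [← (mem_linBilin_invariants.1 hq g).2 (φ g a) (φ g b), inv_self_apply, inv_self_apply]

/-- Equivariant pairs of a linear map and an alternating bilinear map. -/
noncomputable def Representation.equivariantLinAlt {k G N M : Type*} [CommRing k] [Group G] [AddCommGroup N]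
    [Module k N] [AddCommGroup M] [Module k M] (φ : Representation k G N)
    (π : Representation k G M) :
    Submodule k ((N →ₗ[k] M) × (N →ₗ[k] N →ₗ[k] M)) where
  carrier := {q | q ∈ (φ.linBilin π).invariants ∧ ∀ a, q.2 a a = 0}
  zero_mem' := ⟨Submodule.zero_mem _, fun _ => rfl⟩
  add_mem' hq hr := ⟨Submodule.add_mem _ hq.1 hr.1, fun a => by simp [hq.2 a, hr.2 a]⟩
  smul_mem' c q hq := ⟨Submodule.smul_mem _ c hq.1, fun a => by simp [hq.2 a]⟩

end MapCocycle

/-! ### Kernel-invariant homogeneous cochains and the twisted transfer -/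

section HomogeneousCochains

namespace GroupExtension

variable {p : ℕ} {N Γ G M : Type*} [AddCommGroup N] [Module (ZMod p) N] [Group Γ] [Group G]
  [AddCommGroup M] [Module (ZMod p) M]

/-- The inclusion of the kernel, written additively. -/
def incl (E : GroupExtension (Multiplicative N) Γ G) (n : N) : Γ :=
  E.inl (Multiplicative.ofAdd n)

variable (E : GroupExtension (Multiplicative N) Γ G)

theorem incl_add (a b : N) : E.incl (a + b) = E.incl a * E.incl b := map_mul E.inl _ _

theorem incl_neg (a : N) : E.incl (-a) = (E.incl a)⁻¹ := map_inv E.inl _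

theorem rightHom_incl (a : N) : E.rightHom (E.incl a) = 1 := E.rightHom_inl _

theorem rightHom_surjInv (g : G) :
    E.rightHom (Function.surjInv E.rightHom_surjective g) = g :=
  Function.surjInv_eq E.rightHom_surjective g

theorem exists_eq_mul_incl {a b : Γ} (h : E.rightHom a = E.rightHom b) :
    ∃ n, a = b * E.incl n := by
  have hk : b⁻¹ * a ∈ E.inl.range := by
    rw [E.range_inl_eq_ker_rightHom, MonoidHom.mem_ker, map_mul, map_inv, h, inv_mul_cancel]
  obtain ⟨m, hm⟩ := hk
  exact ⟨m.toAdd, by rw [incl, ofAdd_toAdd, hm, mul_inv_cancel_left]⟩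

theorem incl_kernelRep_mul (e : Γ) (n : N) :
    E.incl (E.kernelRep (p := p) (E.rightHom e) n) * e = e * E.incl n := by
  rw [incl, inl_kernelRep, inv_mul_cancel_right, incl]

/-- Homogeneous 2-cocycles of `Γ` that are invariant under the kernel of the extension, for
coefficients on which the kernel acts trivially. -/
structure IsKernelCocycle (C : Γ → Γ → Γ → M) : Prop where
  closed : ∀ x y z w, C y z w - C x z w + C x y w - C x y z = 0
  incl_mul : ∀ n x y z, C (E.incl n * x) (E.incl n * y) (E.incl n * z) = C x y z

/-- The prism operator of a self-map `r` of `Γ`. -/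
def prism (C : Γ → Γ → Γ → M) (r : Γ → Γ) (x y : Γ) : M := C x (r x) (r y) - C x y (r y)

namespace IsKernelCocycle

variable {E} {C : Γ → Γ → Γ → M} (hC : E.IsKernelCocycle C)
include hC

/-- Cut the prism between the triangles `(x, y, z)` and `(r x, r y, r z)` into three tetrahedra and
use closedness on each. -/
theorem sub_eq_prism (r : Γ → Γ) (x y z : Γ) :
    C (r x) (r y) (r z) - C x y z = prism C r y z - prism C r x z + prism C r x y := by
  have h1 := hC.closed x (r x) (r y) (r z)
  have h2 := hC.closed x y (r y) (r z)
  have h3 := hC.closed x y z (r z)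
  simp only [prism]
  linear_combination (norm := module) h1 - h2 + h3

theorem prism_incl_mul {r : Γ → Γ} (hr : ∀ n x, r (E.incl n * x) = E.incl n * r x) (n : N)
    (x y : Γ) : prism C r (E.incl n * x) (E.incl n * y) = prism C r x y := by
  simp only [prism, hr, hC.incl_mul]

variable (p) in
/-- The restriction of a kernel-invariant cocycle to the coset `N t`. -/
def onCoset (t : Γ) : trivialCocycles p N M :=
  ⟨fun a b => C t (E.incl a * t) (E.incl (a + b) * t), fun a b c => by
    have h1 := hC.closed t (E.incl a * t) (E.incl (a + b) * t) (E.incl (a + b + c) * t)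
    have h2 := hC.incl_mul a t (E.incl b * t) (E.incl (b + c) * t)
    simp only [← mul_assoc, ← incl_add, ← add_assoc] at h1 h2 ⊢
    linear_combination (norm := module) h2 - h1⟩

/-- Right multiplication by `t` commutes with left translation by the kernel, so its prism is
kernel-invariant and makes the two restrictions cohomologous. -/
theorem powerCommutator_onCoset [Fact p.Prime] (hp : p ≠ 2) (t : Γ) :
    powerCommutator N M hp (hC.onCoset p t) = powerCommutator N M hp (hC.onCoset p 1) := by
  refine powerCommutator_eq_of_coboundary hp (fun a => prism C (· * t) 1 (E.incl a))
    fun a b => ?_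
  have h1 := hC.sub_eq_prism (· * t) 1 (E.incl a) (E.incl (a + b))
  have h2 := hC.prism_incl_mul (r := (· * t)) (fun n x => mul_assoc _ _ _) a 1 (E.incl b)
  rw [← incl_add, mul_one] at h2
  simp only [onCoset, mul_one, one_mul] at h1 ⊢
  rw [h1, h2]

end IsKernelCocycle

variable [Fintype G] (π : Representation (ZMod p) G M) (θ : M →ₗ[ZMod p] M)

/-- The transfer of a cochain from the kernel to `Γ`, twisted by an operator `θ` on the
coefficients. -/
noncomputable def transfer {X : Type*} [MulAction Γ X] (c : X → M) (x : X) : M :=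
  ∑ g : G, π g (θ (c ((Function.surjInv E.rightHom_surjective g)⁻¹ • x)))

variable {E} in
theorem apply_inv_smul_eq {X : Type*} [MulAction Γ X] {c : X → M}
    (hc : ∀ n x, c (E.incl n • x) = c x) {a b : Γ} (h : E.rightHom a = E.rightHom b) (x : X) :
    c (a⁻¹ • x) = c (b⁻¹ • x) := by
  obtain ⟨n, rfl⟩ := E.exists_eq_mul_incl h
  rw [mul_inv_rev, mul_smul, ← incl_neg, hc]

/-- Reindex the sum by the image of `γ` in `G`; the change of lifts is harmless because `c` is
kernel-invariant. -/
theorem transfer_smul {X : Type*} [MulAction Γ X] {c : X → M}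
    (hc : ∀ n x, c (E.incl n • x) = c x) (γ : Γ) (x : X) :
    E.transfer π θ c (γ • x) = π (E.rightHom γ) (E.transfer π θ c x) := by
  rw [transfer, transfer, map_sum]
  refine (Fintype.sum_equiv (Equiv.mulLeft (E.rightHom γ)) _ _ fun g => ?_).symm
  have h : E.rightHom (Function.surjInv E.rightHom_surjective (E.rightHom γ * g))
      = E.rightHom (γ * Function.surjInv E.rightHom_surjective g) := by
    rw [map_mul, rightHom_surjInv, rightHom_surjInv]
  rw [Equiv.coe_mulLeft, map_mul, apply_inv_smul_eq hc h, smul_smul, mul_inv_rev,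
    inv_mul_cancel_right]
  rfl

theorem transfer_eq_self (hθ : ∀ m, ∑ g, π g (θ (π g⁻¹ m)) = m) {X : Type*} [MulAction Γ X]
    {c : X → M} (hc : ∀ γ x, c (γ • x) = π (E.rightHom γ) (c x)) (x : X) :
    E.transfer π θ c x = c x := by
  rw [transfer]
  conv_rhs => rw [← hθ (c x)]
  refine Finset.sum_congr rfl fun g _ => ?_
  rw [hc, map_inv, rightHom_surjInv]

variable {E} in
/-- The transfer of a kernel-invariant cocycle. -/
theorem powerCommutator_transfer [Fact p.Prime] (hp : p ≠ 2)
    (hθ : ∀ m, ∑ g, π g (θ (π g⁻¹ m)) = m) {C : Γ → Γ → Γ → M} (hC : E.IsKernelCocycle C)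
    (hinv : powerCommutator N M hp (hC.onCoset p 1) ∈ (E.kernelRep.linBilin π).invariants)
    (f : trivialCocycles p N M)
    (hf : ∀ a b, f.1 a b = E.transfer π θ (fun x : Γ × Γ × Γ => C x.1 x.2.1 x.2.2)
      (1, E.incl a, E.incl (a + b))) :
    powerCommutator N M hp f = powerCommutator N M hp (hC.onCoset p 1) := by
  set q := powerCommutator N M hp (hC.onCoset p 1) with hq
  -- Translating by the inverse of a lift of `g` moves the kernel to another coset, with coordinates
  -- twisted by `φ g⁻¹`.
  have hfs : f = ∑ g : G, trivialCocycles.map (E.kernelRep g⁻¹) (π g ∘ₗ θ)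
      (hC.onCoset p (Function.surjInv E.rightHom_surjective g)⁻¹) := by
    refine Subtype.ext (funext₂ fun a b => ?_)
    rw [hf, transfer]
    simp only [AddSubmonoidClass.coe_finsetSum, Finset.sum_apply]
    refine Finset.sum_congr rfl fun g _ => ?_
    have hi : ∀ n, E.incl (E.kernelRep (p := p) g⁻¹ n) *
        (Function.surjInv E.rightHom_surjective g)⁻¹
          = (Function.surjInv E.rightHom_surjective g)⁻¹ * E.incl n := fun n => by
      rw [← incl_kernelRep_mul (p := p), map_inv E.rightHom, rightHom_surjInv]
    simp only [trivialCocycles.map, IsKernelCocycle.onCoset, ← map_add, hi, Prod.smul_mk,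
      smul_eq_mul, mul_one, LinearMap.comp_apply]
  rw [hfs, map_sum]
  -- The coset does not affect the invariants, and equivariance of `q` trades `φ g⁻¹` on the source
  -- for `π g⁻¹` on the target, so that `hθ` sums the terms to `q`.
  have hterm : ∀ g : G, powerCommutator N M hp (trivialCocycles.map (E.kernelRep g⁻¹) (π g ∘ₗ θ)
      (hC.onCoset p (Function.surjInv E.rightHom_surjective g)⁻¹))
        = ((π g ∘ₗ θ ∘ₗ π g⁻¹) ∘ₗ q.1, q.2.compr₂ (π g ∘ₗ θ ∘ₗ π g⁻¹)) := fun g => by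
    rw [powerCommutator_map hp _ _ _ _ fun _ _ => rfl, hC.powerCommutator_onCoset, ← hq]
    have h1 := Representation.apply_fst_of_mem_invariants hinv g⁻¹
    have h2 := Representation.apply_snd_of_mem_invariants hinv g⁻¹
    ext a b
    · simp [h1]
    · simp [h2]
  simp only [hterm]
  ext a b
  · rw [Prod.fst_sum, LinearMap.sum_apply]
    exact hθ _
  · rw [Prod.snd_sum, LinearMap.sum_apply, LinearMap.sum_apply]
    exact hθ _

/-- There is an equivariant retraction of `Γ` onto the kernel. -/
theorem exists_equivariant_retraction :
    ∃ r : Γ → N, ∀ n x, r (E.incl n * x) = n + r x := by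
  have h : ∀ x : Γ, ∃ n, E.incl n * Function.surjInv E.rightHom_surjective (E.rightHom x) = x :=
    fun x => by
      have hx : E.rightHom (x * (Function.surjInv E.rightHom_surjective (E.rightHom x))⁻¹)
          = E.rightHom 1 := by
        rw [map_mul, map_inv, rightHom_surjInv, mul_inv_cancel, map_one]
      obtain ⟨n, hn⟩ := E.exists_eq_mul_incl hx
      exact ⟨n, by rw [← one_mul (E.incl n), ← hn, inv_mul_cancel_right]⟩
  choose r hr using h
  refine ⟨r, fun n x => Multiplicative.ofAdd.injective (E.inl_injective ?_)⟩
  change E.incl _ = E.incl _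
  refine mul_right_cancel (b := Function.surjInv E.rightHom_surjective (E.rightHom x)) ?_
  have h1 := hr (E.incl n * x)
  rw [map_mul, rightHom_incl, one_mul] at h1
  rw [h1, incl_add, mul_assoc, hr]

end GroupExtension

end HomogeneousCochains

/-! ### `H²(Γ, M)` as equivariant power maps and pairings -/

section SecondCohomology

namespace GroupExtension

open groupCohomology

variable {p : ℕ} {N Γ G M : Type} [AddCommGroup N] [Module (ZMod p) N] [Group Γ] [Group G]
  [AddCommGroup M] [Module (ZMod p) M]
  (E : GroupExtension (Multiplicative N) Γ G) (π : Representation (ZMod p) G M)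

/-- The `Γ`-module obtained from a `G`-module by inflation. -/
noncomputable abbrev inflation : Rep (ZMod p) Γ :=
  Rep.of (π.comp E.rightHom : Representation (ZMod p) Γ M)

theorem mem_cocycles_inflation {f : Γ × Γ → M} :
    f ∈ cocycles₂ (E.inflation π) ↔ ∀ g h j : Γ,
      f (g * h, j) + f (g, h) = π (E.rightHom g) (f (h, j)) + f (g, h * j) :=
  mem_cocycles₂_iff (A := E.inflation π) f

theorem mem_coboundaries_inflation {f : Γ × Γ → M} :
    f ∈ coboundaries₂ (E.inflation π) ↔ ∃ u : Γ → M, ∀ g h : Γ,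
      π (E.rightHom g) (u h) - u (g * h) + u g = f (g, h) :=
  exists_congr fun _ => funext_iff.trans Prod.forall

/-- Restriction of 2-cocycles to the kernel of the extension. -/
noncomputable def restrictCocycle :
    cocycles₂ (E.inflation π) →ₗ[ZMod p] trivialCocycles p N M where
  toFun f := ⟨fun a b => f.1 (E.incl a, E.incl b), fun a b c => by
    have h := (E.mem_cocycles_inflation π).1 f.2 (E.incl a) (E.incl b) (E.incl c)
    rw [rightHom_incl, map_one, ← incl_add, ← incl_add] at h
    exact h⟩
  map_add' _ _ := rfl
  map_smul' _ _ := rfl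

/-- The homogeneous cochain of an inhomogeneous 2-cochain. -/
def homogenize (f : Γ × Γ → M) (x y z : Γ) : M := π (E.rightHom x) (f (x⁻¹ * y, y⁻¹ * z))

variable {E π} in
theorem homogenize_mul (f : Γ × Γ → M) (γ x y z : Γ) :
    E.homogenize π f (γ * x) (γ * y) (γ * z)
      = π (E.rightHom γ) (E.homogenize π f x y z) := by
  simp only [homogenize, map_mul, mul_inv_rev, mul_assoc, inv_mul_cancel_left]
  rfl

variable {E π} in
theorem isKernelCocycle_homogenize {f : Γ × Γ → M} (hf : f ∈ cocycles₂ (E.inflation π)) :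
    E.IsKernelCocycle (E.homogenize π f) where
  closed x y z w := by
    have h := congrArg (π (E.rightHom x))
      ((E.mem_cocycles_inflation π).1 hf (x⁻¹ * y) (y⁻¹ * z) (z⁻¹ * w))
    rw [map_add, map_add, ← Module.End.mul_apply, ← map_mul π, ← map_mul E.rightHom] at h
    simp only [mul_assoc, mul_inv_cancel_left] at h
    simp only [homogenize]
    linear_combination (norm := module) -h
  incl_mul n x y z := by
    rw [homogenize_mul, rightHom_incl, map_one, Module.End.one_apply]

variable {E π} in
theorem onCoset_homogenize (f : cocycles₂ (E.inflation π)) :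
    (isKernelCocycle_homogenize f.2).onCoset p 1 = E.restrictCocycle π f := by
  refine Subtype.ext (funext₂ fun a b => ?_)
  simp only [IsKernelCocycle.onCoset, homogenize, mul_one, inv_one, one_mul, map_one, incl_add,
    inv_mul_cancel_left]
  rfl

variable [Fact p.Prime] (hp : p ≠ 2)

/-- The power map and the commutator pairing of the restriction of a cocycle to the kernel. -/
noncomputable def kernelInvariant :
    cocycles₂ (E.inflation π) →ₗ[ZMod p] (N →ₗ[ZMod p] M) × (N →ₗ[ZMod p] N →ₗ[ZMod p] M) :=
  powerCommutator N M hp ∘ₗ E.restrictCocycle π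

/-- Translation by `γ` carries the restriction to the coset of `γ⁻¹` to the restriction to the
kernel; both cosets have the same invariants, which yields equivariance. -/
theorem kernelInvariant_mem (f : cocycles₂ (E.inflation π)) :
    E.kernelInvariant π hp f ∈ E.kernelRep.equivariantLinAlt π := by
  refine ⟨Representation.mem_linBilin_invariants.2 fun g => ?_, fun a => sub_self _⟩
  obtain ⟨γ, rfl⟩ := E.rightHom_surjective g
  have hC := isKernelCocycle_homogenize f.2
  have key := powerCommutator_map hp (E.kernelRep (p := p) (E.rightHom γ)⁻¹) (π (E.rightHom γ))
    (hC.onCoset p γ⁻¹) (hC.onCoset p 1) fun a b => by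
      have hi : ∀ n, E.incl (E.kernelRep (p := p) (E.rightHom γ)⁻¹ n) * γ⁻¹ = γ⁻¹ * E.incl n :=
        fun n => by rw [← incl_kernelRep_mul (p := p), map_inv E.rightHom]
      simp only [IsKernelCocycle.onCoset, ← map_add, hi]
      rw [← homogenize_mul]
      simp
  have h1 : powerCommutator N M hp (hC.onCoset p 1) = E.kernelInvariant π hp f :=
    congrArg _ (onCoset_homogenize f)
  rw [hC.powerCommutator_onCoset hp γ⁻¹, h1] at key
  exact ⟨fun a => (LinearMap.congr_fun (congrArg Prod.fst key) a).symm,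
    fun a b => (LinearMap.congr_fun₂ (congrArg Prod.snd key) a b).symm⟩

theorem kernelInvariant_eq_zero_of_mem_coboundaries (f : cocycles₂ (E.inflation π))
    (hf : f.1 ∈ coboundaries₂ (E.inflation π)) : E.kernelInvariant π hp f = 0 := by
  obtain ⟨u, hu⟩ := (E.mem_coboundaries_inflation π).1 hf
  rw [← map_zero (powerCommutator N M hp)]
  refine powerCommutator_eq_of_coboundary hp (fun a => u (E.incl a)) fun a b => ?_
  have h := hu (E.incl a) (E.incl b)
  rw [rightHom_incl, map_one, ← incl_add] at h
  exact (sub_zero _).trans h.symm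

variable [Fintype G] {π} {θ : M →ₗ[ZMod p] M} (hθ : ∀ m, ∑ g, π g (θ (π g⁻¹ m)) = m)
include hθ

theorem mem_coboundaries_of_kernelInvariant_eq_zero (f : cocycles₂ (E.inflation π))
    (hf : E.kernelInvariant π hp f = 0) : f.1 ∈ coboundaries₂ (E.inflation π) := by
  have hC := isKernelCocycle_homogenize f.2
  obtain ⟨t, ht⟩ := exists_coboundary_of_powerCommutator_eq_zero hp _ hf
  obtain ⟨r, hr⟩ := E.exists_equivariant_retraction
  set ι : Γ → Γ := fun x => E.incl (r x) with hι
  have hιm : ∀ n x, ι (E.incl n * x) = E.incl n * ι x := fun n x => by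
    rw [hι, ← incl_add, ← hr]
  -- The prism of `ι` pushes the cocycle into the kernel, where `t` bounds it; thus `K` is a
  -- kernel-invariant cochain bounding the homogenised `f`.
  let K : Γ × Γ → M := fun x => t (r x.2 - r x.1) - prism (E.homogenize π f.1) ι x.1 x.2
  have hK : ∀ (n : N) (x : Γ × Γ), K (E.incl n • x) = K x := fun n x => by
    simp only [K, Prod.smul_fst, Prod.smul_snd, smul_eq_mul, hr, hC.prism_incl_mul hιm,
      add_sub_add_left_eq_sub]
  have hdK : ∀ x y z, K (y, z) - K (x, z) + K (x, y) = E.homogenize π f.1 x y z := by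
    intro x y z
    have h1 := hC.sub_eq_prism ι x y z
    have h2 : E.homogenize π f.1 (ι x) (ι y) (ι z)
        = (E.restrictCocycle π f).1 (r y - r x) (r z - r y) := by
      simp only [homogenize, hι, rightHom_incl, map_one, ← incl_neg, ← incl_add, neg_add_eq_sub]
      rfl
    have h3 := ht (r y - r x) (r z - r y)
    rw [show r y - r x + (r z - r y) = r z - r x by abel] at h3
    simp only [K]
    linear_combination (norm := module) h1 - h2 - h3
  refine (E.mem_coboundaries_inflation π).2
    ⟨fun γ => E.transfer π θ K (1, γ), fun g h => ?_⟩
  -- Equivariance of the transferred `K` turns its homogeneous coboundary at `(1, g, g * h)` into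
  -- the inhomogeneous one.
  have h1 := E.transfer_smul π θ hK g (1, h)
  rw [Prod.smul_mk, smul_eq_mul, smul_eq_mul, mul_one] at h1
  rw [← h1]
  have h2 := E.transfer_eq_self π θ hθ
    (c := fun x : Γ × Γ × Γ => E.homogenize π f.1 x.1 x.2.1 x.2.2)
    (fun γ x => homogenize_mul f.1 γ x.1 x.2.1 x.2.2) (1, g, g * h)
  simp only [← hdK] at h2
  simp only [transfer, map_sub, map_add, Finset.sum_sub_distrib, Finset.sum_add_distrib] at h2 ⊢
  refine h2.trans ?_
  rw [hdK]
  simp [homogenize]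

theorem exists_kernelInvariant_eq [Finite N]
    {q : (N →ₗ[ZMod p] M) × (N →ₗ[ZMod p] N →ₗ[ZMod p] M)}
    (hq : q ∈ E.kernelRep.equivariantLinAlt π) : ∃ f, E.kernelInvariant π hp f = q := by
  obtain ⟨c, hc⟩ := exists_powerCommutator_eq hp q.1 q.2 hq.2
  obtain ⟨r, hr⟩ := E.exists_equivariant_retraction
  -- Pulling `c` back along the retraction extends it to a kernel-invariant cocycle on all of `Γ`;
  -- the transfer then makes it `Γ`-equivariant.
  let C : Γ → Γ → Γ → M := fun x y z => c.1 (r y - r x) (r z - r y)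
  have hC : E.IsKernelCocycle C :=
    { closed := fun x y z w => by
        have h := c.2 (r y - r x) (r z - r y) (r w - r z)
        rw [show r y - r x + (r z - r y) = r z - r x by abel,
          show r z - r y + (r w - r z) = r w - r y by abel] at h
        simp only [C]
        linear_combination (norm := module) -h
      incl_mul := fun n x y z => by simp only [C, hr, add_sub_add_left_eq_sub] }
  have hC1 : hC.onCoset p 1 = c := by
    refine Subtype.ext (funext₂ fun a b => ?_)
    simp only [IsKernelCocycle.onCoset, C, hr, add_sub_cancel_right, add_sub_add_right_eq_sub,
      add_sub_cancel_left]
  let D : Γ × Γ × Γ → M := E.transfer π θ fun x => C x.1 x.2.1 x.2.2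
  have hD : ∀ (γ : Γ) (x : Γ × Γ × Γ), D (γ • x) = π (E.rightHom γ) (D x) :=
    E.transfer_smul π θ fun n x => hC.incl_mul n _ _ _
  have hdD : ∀ x y z w, D (y, z, w) - D (x, z, w) + D (x, y, w) - D (x, y, z) = 0 := by
    intro x y z w
    simp only [D, transfer, ← Finset.sum_sub_distrib, ← Finset.sum_add_distrib, ← map_sub,
      ← map_add, Prod.smul_mk, hC.closed, map_zero, Finset.sum_const_zero]
  have hf : (fun x : Γ × Γ => D (1, x.1, x.1 * x.2)) ∈ cocycles₂ (E.inflation π) := by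
    refine (E.mem_cocycles_inflation π).2 fun g h j => ?_
    rw [← hD]
    have h1 := hdD 1 g (g * h) (g * h * j)
    simp only [Prod.smul_mk, smul_eq_mul, mul_one, ← mul_assoc]
    linear_combination (norm := module) -h1
  refine ⟨⟨_, hf⟩, ?_⟩
  rw [← Prod.mk.eta (p := q), ← hc, ← hC1]
  refine powerCommutator_transfer π θ hp hθ hC ?_ _ fun a b => ?_
  · rw [hC1, hc]
    exact hq.1
  · rw [incl_add]
    rfl

include hp in
theorem nonempty_H2_equiv [Finite N] :
    Nonempty (groupCohomology (E.inflation π) 2 ≃ₗ[ZMod p] E.kernelRep.equivariantLinAlt π) := by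
  let Ψ : cocycles₂ (E.inflation π) →ₗ[ZMod p] E.kernelRep.equivariantLinAlt π :=
    (E.kernelInvariant π hp).codRestrict _ (E.kernelInvariant_mem π hp)
  let P : cocycles₂ (E.inflation π) →ₗ[ZMod p] groupCohomology (E.inflation π) 2 :=
    (H2π (E.inflation π)).hom
  have hP : Function.Surjective P := (ModuleCat.epi_iff_surjective _).1 inferInstance
  have hΨ : Function.Surjective Ψ := fun q =>
    (E.exists_kernelInvariant_eq hp hθ q.2).imp fun f hf => Subtype.ext hf
  have hker : LinearMap.ker P = LinearMap.ker Ψ := by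
    ext f
    rw [LinearMap.mem_ker, LinearMap.mem_ker]
    refine (H2π_eq_zero_iff f).trans (Iff.trans ?_ Subtype.ext_iff.symm)
    exact ⟨E.kernelInvariant_eq_zero_of_mem_coboundaries π hp f,
      E.mem_coboundaries_of_kernelInvariant_eq_zero hp hθ f⟩
  exact ⟨(P.quotKerEquivOfSurjective hP).symm ≪≫ₗ Submodule.quotEquivOfEq _ _ hker ≪≫ₗ
    Ψ.quotKerEquivOfSurjective hΨ⟩

end GroupExtension

end SecondCohomology

/-! ### Higman's criterion for projective modules -/

section Higman

namespace Representation

variable {k G V : Type*} [CommRing k] [Group G] [Fintype G] [AddCommGroup V] [Module k V]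

/-- Higman's criterion: the identity of a projective module is the trace of a linear map. -/
theorem exists_sum_conj_eq_of_projective (ρ : Representation k G V)
    [hρ : Module.Projective (MonoidAlgebra k G) ρ.asModule] :
    ∃ θ : V →ₗ[k] V, ∀ v, ∑ g, ρ g (θ (ρ g⁻¹ v)) = v := by
  obtain ⟨s, hs⟩ := hρ.out
  let c : MonoidAlgebra k G →ₗ[k] k :=
    Finsupp.lapply 1 ∘ₗ (MonoidAlgebra.coeffLinearEquiv k).toLinearMap
  have hc : ∀ a, c a = a.coeff 1 := fun _ => rfl
  let t : (ρ.asModule →₀ MonoidAlgebra k G) →ₗ[k] V :=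
    Finsupp.lsum k fun w => c.smulRight (ρ.asModuleEquiv w)
  -- On the group algebra the coefficient at 1 has trace the identity: `a` is the sum over `g` of
  -- the coefficient of `g⁻¹ a` at 1, times `g`. Projectivity transports this along the splitting
  -- `s`.
  have key : ∀ u : ρ.asModule →₀ MonoidAlgebra k G,
      ∑ g, ρ g (t (MonoidAlgebra.single g⁻¹ (1 : k) • u))
        = ρ.asModuleEquiv (Finsupp.linearCombination (MonoidAlgebra k G) id u) := by
    intro u
    induction u using Finsupp.induction_linear with
    | zero => simp
    | add u u' h h' => simp only [smul_add, map_add, Finset.sum_add_distrib, h, h']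
    | single w a =>
      have ht : ∀ g : G, t (MonoidAlgebra.single g⁻¹ (1 : k) • Finsupp.single w a)
          = a.coeff g • ρ.asModuleEquiv w := fun g => by
        rw [Finsupp.smul_single, Finsupp.lsum_single, LinearMap.smulRight_apply, hc, smul_eq_mul,
          MonoidAlgebra.coeff_single_mul_apply, one_mul, inv_inv, mul_one]
      simp only [ht, Finsupp.linearCombination_single, id, map_smul]
      clear ht
      induction a using MonoidAlgebra.induction_linear with
      | zero => simp
      | add a b h h' =>
        simp only [MonoidAlgebra.coeff_add, Finsupp.add_apply, add_smul, map_add,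
          Finset.sum_add_distrib] at h h' ⊢
        rw [h, h']
      | single h r =>
        classical
        rw [single_smul]
        simp [Finsupp.single_apply, ite_smul]
        rfl
  refine ⟨t ∘ₗ (s.restrictScalars k).comp ρ.asModuleEquiv.symm.toLinearMap, fun v => ?_⟩
  have h := key (s (ρ.asModuleEquiv.symm v))
  rw [hs] at h
  refine Eq.trans (Finset.sum_congr rfl fun g _ => ?_) h
  simp only [LinearMap.comp_apply, LinearEquiv.coe_coe, LinearMap.restrictScalars_apply,
    asModuleEquiv_symm_map_rho, map_smul]
  rfl

/-- Higman's criterion passes from `V` to `End V`. -/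
theorem exists_sum_conj_linHom_eq (ρ : Representation k G V)
    (h : ∃ θ : V →ₗ[k] V, ∀ v, ∑ g, ρ g (θ (ρ g⁻¹ v)) = v) :
    ∃ θ : (V →ₗ[k] V) →ₗ[k] V →ₗ[k] V,
      ∀ f, ∑ g, ρ.linHom ρ g (θ (ρ.linHom ρ g⁻¹ f)) = f := by
  obtain ⟨θ, hθ⟩ := h
  refine ⟨LinearMap.llcomp k V V V θ, fun f => LinearMap.ext fun v => ?_⟩
  rw [LinearMap.sum_apply]
  conv_rhs => rw [← hθ (f v)]
  refine Finset.sum_congr rfl fun g _ => ?_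
  simp

end Representation

end Higman

/-! ### Exterior squares, determinants and alternating forms -/

section ExteriorSquare

open scoped TensorProduct

variable {k W : Type*} [Field k] [AddCommGroup W] [Module k W]

/-- A two-dimensional representation has exterior square its determinant. -/
theorem Representation.nonempty_exteriorSquare_equiv_detRep {G : Type*} [Group G]
    (σ : Representation k G W) (hW : Module.finrank k W = 2) :
    Nonempty (Representation.Equiv σ.exteriorSquare σ.detRep) := by
  have : Module.Finite k W := Module.finite_of_finrank_pos (by omega)
  let b : Module.Basis (Fin 2) k W := Module.finBasisOfFinrankEq k W hW
  let L : ⋀[k]^2 W →ₗ[k] k := exteriorPower.alternatingMapLinearEquiv b.det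
  have hL : Function.Surjective L := fun c => ⟨c • exteriorPower.ιMulti k 2 b, by
    rw [map_smul, exteriorPower.alternatingMapLinearEquiv_apply_ιMulti, b.det_self, smul_eq_mul,
      mul_one]⟩
  have hfin : Module.finrank k (⋀[k]^2 W) = Module.finrank k k := by
    rw [exteriorPower.finrank_eq, hW, Module.finrank_self, Nat.choose_self]
  refine ⟨Representation.Equiv.mk (LinearEquiv.ofBijective L
    ⟨(LinearMap.injective_iff_surjective_of_finrank_eq_finrank hfin).2 hL, hL⟩) fun g => ?_⟩
  refine exteriorPower.linearMap_ext (AlternatingMap.ext fun v => ?_)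
  change L (exteriorPower.map 2 (σ g) (exteriorPower.ιMulti k 2 v))
    = LinearMap.det (σ g) * L (exteriorPower.ιMulti k 2 v)
  rw [exteriorPower.map_apply_ιMulti, exteriorPower.alternatingMapLinearEquiv_apply_ιMulti,
    exteriorPower.alternatingMapLinearEquiv_apply_ιMulti, b.det_comp]

variable {N M : Type*} [AddCommGroup N] [Module k N] [AddCommGroup M] [Module k M]

/-- The wedge product of two vectors, as a bilinear map. -/
noncomputable def wedge : W →ₗ[k] W →ₗ[k] ⋀[k]^2 W :=
  have hs : ∀ x y : W, exteriorPower.ιMulti k 2 ![x, y] = -exteriorPower.ιMulti k 2 ![y, x] :=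
    fun x y => by
      rw [← (exteriorPower.ιMulti k 2).map_swap ![y, x] (Fin.zero_ne_one)]
      congr 1
      ext i
      fin_cases i <;> simp
  LinearMap.mk₂ k (fun x y => exteriorPower.ιMulti k 2 ![x, y])
    (fun x x' y => AlternatingMap.map_vecCons_add _ _ _ _)
    (fun c x y => AlternatingMap.map_vecCons_smul _ _ _ _)
    (fun x y y' => by
      rw [hs, AlternatingMap.map_vecCons_add, neg_add, ← hs, ← hs])
    (fun c x y => by
      rw [hs, AlternatingMap.map_vecCons_smul, ← smul_neg, ← hs])

theorem wedge_apply (x y : W) : wedge (k := k) x y = exteriorPower.ιMulti k 2 ![x, y] := rfl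

theorem wedge_swap (x y : W) : wedge (k := k) y x = -wedge x y := by
  have h : wedge (k := k) (x + y) (x + y) = 0 :=
    (exteriorPower.ιMulti k 2).map_eq_zero_of_eq _ (i := 0) (j := 1) rfl Fin.zero_ne_one
  have h' : ∀ z : W, wedge (k := k) z z = 0 := fun z =>
    (exteriorPower.ιMulti k 2).map_eq_zero_of_eq _ (i := 0) (j := 1) rfl Fin.zero_ne_one
  simp only [map_add, LinearMap.add_apply, h', zero_add, add_zero] at h
  exact eq_neg_of_add_eq_zero_left h

variable (k N) in
/-- The alternating bilinear form of two linear forms, as an alternating map. -/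
noncomputable def alternatingFormOfDual :
    Module.Dual k N [⋀^Fin 2]→ₗ[k] (N →ₗ[k] N →ₗ[k] k) where
  toFun v := LinearMap.mk₂ k (fun a b => v 0 a * v 1 b - v 0 b * v 1 a)
    (fun a a' b => by simp only [map_add]; ring)
    (fun c a b => by simp only [map_smul, smul_eq_mul]; ring)
    (fun a b b' => by simp only [map_add]; ring)
    (fun c a b => by simp only [map_smul, smul_eq_mul]; ring)
  map_update_add' v i x y := by
    ext a b
    fin_cases i <;> simp <;> ring
  map_update_smul' v i c x := by
    ext a b
    fin_cases i <;> simp <;> ring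
  map_eq_zero_of_eq' v i j h hij := by
    have h01 : v 0 = v 1 := by
      fin_cases i <;> fin_cases j <;> first | exact absurd rfl hij | exact h | exact h.symm
    ext a b
    simp only [LinearMap.mk₂_apply, h01, LinearMap.zero_apply]
    ring

/-- The alternating bilinear form of an element of the exterior square of the dual. -/
noncomputable def exteriorSquareForm :
    ⋀[k]^2 (Module.Dual k N) →ₗ[k] N →ₗ[k] N →ₗ[k] k :=
  exteriorPower.alternatingMapLinearEquiv (N := N →ₗ[k] N →ₗ[k] k) (alternatingFormOfDual k N)

theorem exteriorSquareForm_ιMulti (v : Fin 2 → Module.Dual k N) (a b : N) :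
    exteriorSquareForm (exteriorPower.ιMulti k 2 v) a b = v 0 a * v 1 b - v 0 b * v 1 a := by
  rw [exteriorSquareForm, exteriorPower.alternatingMapLinearEquiv_apply_ιMulti]
  rfl

theorem exteriorSquareForm_self (w : ⋀[k]^2 (Module.Dual k N)) (a : N) :
    exteriorSquareForm w a a = 0 := by
  have h : (LinearMap.applyₗ a ∘ₗ LinearMap.applyₗ a) ∘ₗ exteriorSquareForm = (0 : _ →ₗ[k] k) := by
    refine exteriorPower.linearMap_ext (AlternatingMap.ext fun v => ?_)
    exact (exteriorSquareForm_ιMulti v a a).trans (sub_self _)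
  exact LinearMap.congr_fun h w

/-- The alternating bilinear map with values in `M` of an element of `⋀² N* ⊗ M`. -/
noncomputable def exteriorSquareTensorForm :
    ⋀[k]^2 (Module.Dual k N) ⊗[k] M →ₗ[k] N →ₗ[k] N →ₗ[k] M :=
  TensorProduct.lift (LinearMap.mk₂ k
    (fun w m => (exteriorSquareForm w).compr₂ (LinearMap.toSpanSingleton k M m))
    (fun w w' m => by ext; simp [add_smul])
    (fun c w m => by ext; simp [mul_smul])
    (fun w m m' => by ext; simp)
    (fun c w m => by ext; simp [smul_comm c]))

theorem exteriorSquareTensorForm_tmul (w : ⋀[k]^2 (Module.Dual k N)) (m : M) (a b : N) :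
    exteriorSquareTensorForm (w ⊗ₜ[k] m) a b = exteriorSquareForm w a b • m := rfl

theorem exteriorSquareTensorForm_self (x : ⋀[k]^2 (Module.Dual k N) ⊗[k] M) (a : N) :
    exteriorSquareTensorForm x a a = 0 := by
  induction x using TensorProduct.induction_on with
  | zero => rfl
  | tmul w m => rw [exteriorSquareTensorForm_tmul, exteriorSquareForm_self, zero_smul]
  | add x y hx hy => rw [map_add, LinearMap.add_apply, LinearMap.add_apply, hx, hy, add_zero]

variable {ι : Type*} [Fintype ι] [DecidableEq ι] (b : Module.Basis ι k N)

/-- The element of `⋀² N* ⊗ M` given by the coefficients of a bilinear map in a basis. -/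
noncomputable def Module.Basis.tensorOfForm :
    (N →ₗ[k] N →ₗ[k] M) →ₗ[k] ⋀[k]^2 (Module.Dual k N) ⊗[k] M :=
  ∑ i, ∑ j, TensorProduct.mk k _ M ((2 : k)⁻¹ • wedge (b.coord i) (b.coord j)) ∘ₗ
    LinearMap.applyₗ (b j) ∘ₗ LinearMap.applyₗ (b i)

theorem Module.Basis.tensorOfForm_apply (B : N →ₗ[k] N →ₗ[k] M) :
    b.tensorOfForm B
      = ∑ i, ∑ j, ((2 : k)⁻¹ • wedge (b.coord i) (b.coord j)) ⊗ₜ[k] B (b i) (b j) := by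
  simp [tensorOfForm, LinearMap.sum_apply, TensorProduct.smul_tmul']

/-- On a pure wedge, expanding in the dual basis gives half of `v₀ ∧ v₁ - v₁ ∧ v₀`, which is `v₀ ∧
v₁`. -/
theorem Module.Basis.tensorOfForm_exteriorSquareTensorForm (h2 : (2 : k) ≠ 0)
    (x : ⋀[k]^2 (Module.Dual k N) ⊗[k] M) : b.tensorOfForm (exteriorSquareTensorForm x) = x := by
  have h : ∀ m : M, (b.tensorOfForm ∘ₗ exteriorSquareTensorForm) ∘ₗ (TensorProduct.mk k _ M).flip m
      = (TensorProduct.mk k (⋀[k]^2 (Module.Dual k N)) M).flip m := by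
    refine fun m => exteriorPower.linearMap_ext (N := ⋀[k]^2 (Module.Dual k N) ⊗[k] M)
      (AlternatingMap.ext fun v => ?_)
    change b.tensorOfForm (exteriorSquareTensorForm (exteriorPower.ιMulti k 2 v ⊗ₜ[k] m))
      = exteriorPower.ιMulti k 2 v ⊗ₜ[k] m
    have hv : ∀ f : Module.Dual k N, ∑ i, f (b i) • b.coord i = f := fun f =>
      b.ext fun j => by simp
    have hw : ∀ f f' : Module.Dual k N,
        ∑ i, ∑ j, (f (b i) * f' (b j)) • wedge (b.coord i) (b.coord j) = wedge (k := k) f f' := by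
      intro f f'
      conv_rhs => rw [← hv f, ← hv f']
      simp only [map_sum, LinearMap.sum_apply, map_smul, LinearMap.smul_apply, Finset.smul_sum,
        smul_smul]
      rw [Finset.sum_comm]
      refine Finset.sum_congr rfl fun i _ => Finset.sum_congr rfl fun j _ => ?_
      rw [mul_comm]
    have hw' : ∑ i, ∑ j, (v 0 (b j) * v 1 (b i)) • wedge (b.coord i) (b.coord j)
        = wedge (k := k) (v 1) (v 0) := by
      rw [← hw]
      simp only [mul_comm]
    rw [b.tensorOfForm_apply]
    have ht : ∀ (c : k) (w : ⋀[k]^2 (Module.Dual k N)),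
        ((2 : k)⁻¹ • w) ⊗ₜ[k] (c • m) = ((2 : k)⁻¹ • c • w) ⊗ₜ[k] m := fun c w => by
      rw [TensorProduct.tmul_smul, TensorProduct.smul_tmul', smul_comm]
    simp only [exteriorSquareTensorForm_tmul, exteriorSquareForm_ιMulti, ht,
      ← TensorProduct.sum_tmul, ← Finset.smul_sum]
    have hsub : ∀ (c d : k) (w : ⋀[k]^2 (Module.Dual k N)), (c - d) • w = c • w - d • w :=
      fun c d w => sub_smul c d w
    simp only [hsub, Finset.sum_sub_distrib, hw, hw']
    rw [wedge_swap (v 0), sub_neg_eq_add, ← two_smul k, smul_smul, inv_mul_cancel₀ h2, one_smul]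
    rw [wedge_apply]
    congr 2
    ext i
    fin_cases i <;> rfl
  induction x using TensorProduct.induction_on with
  | zero => simp only [map_zero]
  | tmul w m => exact LinearMap.congr_fun (h m) w
  | add x y hx hy => simp only [map_add, hx, hy]

/-- At `(b i, b j)` the index pairs `(i, j)` and `(j, i)` contribute equally by skew-symmetry, and
the factor one half compensates. -/
theorem Module.Basis.exteriorSquareTensorForm_tensorOfForm (h2 : (2 : k) ≠ 0)
    {B : N →ₗ[k] N →ₗ[k] M} (hB : ∀ a, B a a = 0) :
    exteriorSquareTensorForm (b.tensorOfForm B) = B := by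
  have hB' : ∀ x y, B y x = -B x y := fun x y => by
    have h := hB (x + y)
    simp only [map_add, LinearMap.add_apply, hB, zero_add, add_zero] at h
    exact eq_neg_of_add_eq_zero_left h
  refine b.ext fun i => b.ext fun j => ?_
  rw [b.tensorOfForm_apply]
  simp only [map_sum, LinearMap.sum_apply, exteriorSquareTensorForm_tmul, map_smul, wedge_apply,
    LinearMap.smul_apply, exteriorSquareForm_ιMulti]
  simp [Finsupp.single_apply, sub_smul, mul_sub, Finset.sum_sub_distrib, hB' (b i) (b j),
    ← two_smul k, smul_smul, mul_inv_cancel₀ h2]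

end ExteriorSquare

/-! ### Fixed points of the tensor modules as equivariant pairs -/

section FixedPoints

open scoped TensorProduct

namespace Representation

variable {k G N V : Type*} [Field k] [Group G] [AddCommGroup N] [Module k N] [Module.Finite k N]
  [AddCommGroup V] [Module k V] [Module.Finite k V]

variable (k N V) in
/-- `N* ⊗ V* ⊗ V` is the space of linear maps from `N` to `End V`. -/
noncomputable def tensorLinEquiv :
    (Module.Dual k N ⊗[k] Module.Dual k V) ⊗[k] V ≃ₗ[k] N →ₗ[k] V →ₗ[k] V :=
  _root_.TensorProduct.assoc k _ _ _ ≪≫ₗ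
    _root_.TensorProduct.congr (LinearEquiv.refl k _) (dualTensorHomEquiv (R := k) (M := V) (N := V)) ≪≫ₗ
      dualTensorHomEquiv (R := k) (M := N) (N := V →ₗ[k] V)

theorem tensorLinEquiv_tmul (f : Module.Dual k N) (e : Module.Dual k V) (v : V) (a : N) (w : V) :
    tensorLinEquiv k N V ((f ⊗ₜ e) ⊗ₜ v) a w = f a • e w • v := by
  simp [tensorLinEquiv]

variable (k N V) in
/-- `⋀² N* ⊗ V* ⊗ V` embeds into the bilinear maps from `N` to `End V`. -/
noncomputable def tensorBilin :
    (⋀[k]^2 (Module.Dual k N) ⊗[k] Module.Dual k V) ⊗[k] V →ₗ[k] N →ₗ[k] N →ₗ[k] V →ₗ[k] V :=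
  exteriorSquareTensorForm ∘ₗ (_root_.TensorProduct.assoc k _ _ _ ≪≫ₗ
    _root_.TensorProduct.congr (LinearEquiv.refl k _)
      (dualTensorHomEquiv (R := k) (M := V) (N := V))).toLinearMap

theorem tensorBilin_tmul (f : ⋀[k]^2 (Module.Dual k N)) (e : Module.Dual k V) (v : V) (a b : N)
    (w : V) : tensorBilin k N V ((f ⊗ₜ e) ⊗ₜ v) a b w = exteriorSquareForm f a b • e w • v := by
  simp [tensorBilin, exteriorSquareTensorForm_tmul]

theorem tensorLinEquiv_comm (φ : Representation k G N) (ρ : Representation k G V) (g : G)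
    (x : (Module.Dual k N ⊗[k] Module.Dual k V) ⊗[k] V) :
    tensorLinEquiv k N V (tprod (tprod φ.dual ρ.dual) ρ g x)
      = φ.linHom (ρ.linHom ρ) g (tensorLinEquiv k N V x) := by
  induction x using TensorProduct.induction_on with
  | zero => simp only [map_zero]
  | add x y hx hy => simp only [map_add, hx, hy]
  | tmul y v =>
    induction y using TensorProduct.induction_on with
    | zero => simp only [TensorProduct.zero_tmul, map_zero]
    | add x y hx hy => simp only [TensorProduct.add_tmul, map_add, hx, hy]
    | tmul f e =>
      ext a w
      simp [tensorLinEquiv_tmul, Module.Dual.transpose_apply]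

theorem exteriorSquareForm_exteriorSquare (φ : Representation k G N) (g : G)
    (x : ⋀[k]^2 (Module.Dual k N)) (a b : N) :
    exteriorSquareForm (φ.dual.exteriorSquare g x) a b
      = exteriorSquareForm x (φ g⁻¹ a) (φ g⁻¹ b) := by
  have h : (LinearMap.applyₗ b ∘ₗ LinearMap.applyₗ a) ∘ₗ exteriorSquareForm ∘ₗ
      φ.dual.exteriorSquare g = (LinearMap.applyₗ (φ g⁻¹ b) ∘ₗ
        LinearMap.applyₗ (φ g⁻¹ a)) ∘ₗ (exteriorSquareForm : _ →ₗ[k] N →ₗ[k] N →ₗ[k] k) := by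
    refine exteriorPower.linearMap_ext (AlternatingMap.ext fun v => ?_)
    change exteriorSquareForm (exteriorPower.map 2 (φ.dual g) (exteriorPower.ιMulti k 2 v)) a b
      = exteriorSquareForm (exteriorPower.ιMulti k 2 v) (φ g⁻¹ a) (φ g⁻¹ b)
    rw [exteriorPower.map_apply_ιMulti, exteriorSquareForm_ιMulti, exteriorSquareForm_ιMulti]
    rfl
  exact LinearMap.congr_fun h x

theorem tensorBilin_comm (φ : Representation k G N) (ρ : Representation k G V) (g : G)
    (x : (⋀[k]^2 (Module.Dual k N) ⊗[k] Module.Dual k V) ⊗[k] V) :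
    tensorBilin k N V (tprod (tprod φ.dual.exteriorSquare ρ.dual) ρ g x)
      = φ.linHom (φ.linHom (ρ.linHom ρ)) g (tensorBilin k N V x) := by
  induction x using TensorProduct.induction_on with
  | zero => simp only [map_zero]
  | add x y hx hy => simp only [map_add, hx, hy]
  | tmul y v =>
    induction y using TensorProduct.induction_on with
    | zero => simp only [TensorProduct.zero_tmul, map_zero]
    | add x y hx hy => simp only [TensorProduct.add_tmul, map_add, hx, hy]
    | tmul f e =>
      ext a b w
      simp [tensorBilin_tmul, Module.Dual.transpose_apply, exteriorSquareForm_exteriorSquare]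

/-- The map `T` is injective and equivariant with image the pairs whose form is alternating;
injectivity forces preimages of invariant pairs to be fixed. -/
theorem nonempty_fixedTensorSum_equiv (h2 : (2 : k) ≠ 0) (φ : Representation k G N)
    (ρ : Representation k G V) :
    Nonempty (fixedTensorSum φ.dual φ.dual.exteriorSquare ρ ≃ₗ[k]
      φ.equivariantLinAlt (ρ.linHom ρ)) := by
  classical
  let b := Module.finBasis k N
  let T := (tensorLinEquiv k N V).toLinearMap.prodMap (tensorBilin k N V)
  have hinj : Function.Injective (tensorBilin k N V) :=
    (Function.LeftInverse.injective (b.tensorOfForm_exteriorSquareTensorForm h2)).comp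
      (LinearEquiv.injective _)
  have hT : Function.Injective T := fun x y h => Prod.ext
    ((tensorLinEquiv k N V).injective (congrArg Prod.fst h)) (hinj (congrArg Prod.snd h))
  have hcomm : ∀ g x, T (prod (tprod (tprod φ.dual ρ.dual) ρ)
      (tprod (tprod φ.dual.exteriorSquare ρ.dual) ρ) g x) = φ.linBilin (ρ.linHom ρ) g (T x) :=
    fun g x => Prod.ext (tensorLinEquiv_comm φ ρ g x.1) (tensorBilin_comm φ ρ g x.2)
  have hmap : (fixedTensorSum φ.dual φ.dual.exteriorSquare ρ).map T
      = φ.equivariantLinAlt (ρ.linHom ρ) := by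
    apply le_antisymm
    · rintro _ ⟨x, hx, rfl⟩
      exact ⟨fun g => by rw [← hcomm, hx g], exteriorSquareTensorForm_self _⟩
    · rintro q ⟨hq, halt⟩
      obtain ⟨y, hy⟩ : ∃ y, tensorBilin k N V y = q.2 := by
        let e := _root_.TensorProduct.assoc k (⋀[k]^2 (Module.Dual k N)) (Module.Dual k V) V ≪≫ₗ
          _root_.TensorProduct.congr (LinearEquiv.refl k _)
            (dualTensorHomEquiv (R := k) (M := V) (N := V))
        exact ⟨e.symm (b.tensorOfForm q.2), (congrArg _ (e.apply_symm_apply _)).trans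
          (b.exteriorSquareTensorForm_tensorOfForm h2 halt)⟩
      have hx : T ((tensorLinEquiv k N V).symm q.1, y) = q :=
        Prod.ext ((tensorLinEquiv k N V).apply_symm_apply _) hy
      refine ⟨_, fun g => hT ?_, hx⟩
      rw [hcomm, hx, hq g]
  exact ⟨Submodule.equivMapOfInjective T hT _ ≪≫ₗ LinearEquiv.ofEq _ _ hmap⟩

end Representation

end FixedPoints

/-! ### The main theorem -/

theorem theorem3p1 (p : ℕ) [Fact p.Prime] (hp : p ≠ 2)
    (N Γ G : Type) [AddCommGroup N] [Module (ZMod p) N] [Finite N]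
    [Group Γ] [Group G] [Finite G]
    (E : GroupExtension (Multiplicative N) Γ G) :
    (∀ (V : Type) [AddCommGroup V] [Module (ZMod p) V] [Module.Finite (ZMod p) V]
      (ρ : Representation (ZMod p) G V)
      [Module.Projective (MonoidAlgebra (ZMod p) G) ρ.asModule],
      Nonempty
        (groupCohomology
            (Rep.of (Representation.linHom (ρ.comp E.rightHom) (ρ.comp E.rightHom))) 2
          ≃ₗ[ZMod p]
        Representation.fixedTensorSum (E.kernelRep (p := p)).dual
          (E.kernelRep (p := p)).dual.exteriorSquare ρ)) ∧
    (Module.finrank (ZMod p) N = 2 →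
      Nonempty (Representation.Equiv
        (E.kernelRep (p := p)).dual.exteriorSquare (E.kernelRep (p := p)).dual.detRep)) := by
  have : Module.Finite (ZMod p) N := Module.Finite.of_finite
  refine ⟨fun V _ _ _ ρ _ => ?_, fun hN =>
    Representation.nonempty_exteriorSquare_equiv_detRep _ ?_⟩
  · cases nonempty_fintype G
    obtain ⟨θ, hθ⟩ := ρ.exists_sum_conj_linHom_eq ρ.exists_sum_conj_eq_of_projective
    have hinf : Rep.of (Representation.linHom (ρ.comp E.rightHom) (ρ.comp E.rightHom))
        = E.inflation (ρ.linHom ρ) := by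
      congr 1
      ext γ f v
      simp
    rw [hinf]
    obtain ⟨e⟩ := E.nonempty_H2_equiv hp hθ
    obtain ⟨e'⟩ := Representation.nonempty_fixedTensorSum_equiv (ZMod.two_ne_zero_of_ne_two hp)
      E.kernelRep ρ
    exact ⟨e ≪≫ₗ e'.symm⟩
  · rw [Subspace.dual_finrank_eq, hN]
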